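/- Let $v_1,v_2,v_3,v_4$ be the vectors from the centre of a regular tetrahedron in $\mathbb R^3$ to its vertices, let $L=\mathbb Z v_1+\dots+\mathbb Z v_4\cong\mathbb Z^4/\mathbb Z(1,1,1,1)$ be the tetrahedral lattice, and let $S_4$ act on $L$ by permuting the $v_i$. For $n\ge 1$ let $f(n)$ be the number of $S_4$-orbits of sublattices of index $n$ in $L$. (a) For every $n\ge1$, $f(n)$ is the number of inequivalent Abelian orbifolds $\mathbb C^4/\Gamma$ with $|\Gamma|=n$, that is, the number of subgroups $\Gamma$ of order $n$ of the group of diagonal matrices of determinant $1$ in $GL_4(\mathbb C)$, counted up to permutations of the four coordinates. (b) As $N\to\infty$, $$\sum_{n=1}^N f(n)\sim\frac{\zeta(2)\zeta(3)}{72}N^3,$$ and $\left|\frac{\zeta(2)\zeta(3)}{72}-0.0274\right|<10^{-4}$. (c) The Dirichlet series $F(s)=\sum_{n\ge1}f(n)n^{-s}$ converges absolutely for $\operatorname{Re}s>3$. It continues analytically to $\{\operatorname{Re}s>2\}\setminus\{3\}$, and at $s=3$, its rightmost pole, it has a simple pole with residue $\zeta(2)\zeta(3)/24$. -/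

import Mathlib

open Filter Topology Asymptotics

/-- The permutation `σ` of the four coordinates, as an automorphism of the additive group `ℤ⁴`:
it sends the basis vector `e j` to `e (σ j)`. -/
def permZ4 (σ : Equiv.Perm (Fin 4)) : (Fin 4 → ℤ) →+ (Fin 4 → ℤ) where
  toFun x := fun i => x (σ.symm i)
  map_zero' := rfl
  map_add' _ _ := rfl

/-- The tetrahedral lattice: the free abelian group of rank three generated by the four vectors
`v 0, v 1, v 2, v 3` that point from the centre of a regular tetrahedron to its vertices. Their only
relation is `v 0 + v 1 + v 2 + v 3 = 0`, so this is `ℤ⁴` modulo `(1, 1, 1, 1)`. -/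
abbrev TetraLattice : Type :=
  (Fin 4 → ℤ) ⧸ AddSubgroup.zmultiples (fun _ : Fin 4 => (1 : ℤ))

/-- The symmetry group `S₄` of the tetrahedron acts on the lattice by permuting the `v j`. -/
def tetraPerm (σ : Equiv.Perm (Fin 4)) : TetraLattice →+ TetraLattice :=
  QuotientAddGroup.map _ _ (permZ4 σ) (by
    rw [AddSubgroup.zmultiples_le]
    exact AddSubgroup.mem_zmultiples _)

theorem tetraPerm_refl : tetraPerm (Equiv.refl _) = AddMonoidHom.id _ := by
  ext x : 2
  rfl

theorem tetraPerm_comp (σ τ : Equiv.Perm (Fin 4)) :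
    (tetraPerm σ).comp (tetraPerm τ) = tetraPerm (τ.trans σ) := by
  ext x : 2
  rfl

/-- The sublattices of index `n` of the tetrahedral lattice. -/
def TetraSublattice (n : ℕ) : Type := {A : AddSubgroup TetraLattice // A.index = n}

/-- Two sublattices of index `n` are equivalent if they lie in the same `S₄`-orbit. -/
def sublatticeSetoid (n : ℕ) : Setoid (TetraSublattice n) where
  r A B := ∃ σ : Equiv.Perm (Fin 4), A.1.map (tetraPerm σ) = B.1
  iseqv :=
    { refl := fun A => ⟨Equiv.refl _, by rw [tetraPerm_refl, AddSubgroup.map_id]⟩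
      symm := by
        rintro A B ⟨σ, h⟩
        refine ⟨σ.symm, ?_⟩
        rw [← h, AddSubgroup.map_map, tetraPerm_comp, Equiv.self_trans_symm, tetraPerm_refl,
          AddSubgroup.map_id]
      trans := by
        rintro A B C ⟨σ, h⟩ ⟨τ, k⟩
        refine ⟨σ.trans τ, ?_⟩
        rw [← k, ← h, AddSubgroup.map_map, tetraPerm_comp] }

/-- The counting function `f(n)` of the tetrahedral lattice: the number of `S₄`-orbits of
sublattices of index `n`. -/
noncomputable def tetraCount (n : ℕ) : ℕ := Nat.card (Quotient (sublatticeSetoid n))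

/-- The permutation `σ` of the four coordinates of `(ℂˣ)⁴`. -/
def permTorus (σ : Equiv.Perm (Fin 4)) : (Fin 4 → ℂˣ) →* (Fin 4 → ℂˣ) where
  toFun z := fun i => z (σ.symm i)
  map_one' := rfl
  map_mul' _ _ := rfl

/-- The groups of order `n` that define an Abelian (Calabi-Yau) orbifold of `ℂ⁴`: subgroups, of
order `n`, of the group of diagonal `4 × 4` matrices of determinant one. Here `z` acts on `ℂ⁴` by
`w ↦ (z 0 * w 0, …, z 3 * w 3)`. (A finite such subgroup is automatically unitary.) -/
def OrbifoldGroup (n : ℕ) : Type :=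
  {Γ : Subgroup (Fin 4 → ℂˣ) // (∀ z ∈ Γ, ∏ i, z i = 1) ∧ Nat.card Γ = n}

/-- Two orbifold groups are equivalent if they agree after relabelling the coordinates of `ℂ⁴`. -/
def orbifoldSetoid (n : ℕ) : Setoid (OrbifoldGroup n) where
  r A B := ∃ σ : Equiv.Perm (Fin 4), A.1.map (permTorus σ) = B.1
  iseqv :=
    { refl := fun A => ⟨Equiv.refl _, A.1.map_id⟩
      symm := by
        rintro A B ⟨σ, h⟩
        refine ⟨σ.symm, ?_⟩
        have e : (permTorus σ.symm).comp (permTorus σ) = MonoidHom.id _ := by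
          ext z i
          simp [permTorus]
        rw [← h, Subgroup.map_map, e, Subgroup.map_id]
      trans := by
        rintro A B C ⟨σ, h⟩ ⟨τ, k⟩
        refine ⟨σ.trans τ, ?_⟩
        rw [← k, ← h, Subgroup.map_map]
        rfl }

/-- The number of inequivalent Abelian orbifolds `ℂ⁴ / Γ` with `Γ` of order `n`. -/
noncomputable def abelianOrbifoldCount (n : ℕ) : ℕ := Nat.card (Quotient (orbifoldSetoid n))

/-!
Part (a) is Pontryagin duality. The characters of the torus `(ℂˣ)⁴` are the monomials `z ↦ z ^ x`
with `x ∈ ℤ⁴`, and those of its determinant-one subgroup form the tetrahedral lattice. A finite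
subgroup `Γ` and the lattice of characters trivial on it determine each other
(`torusAnnihilator_latticeAnnihilator`, `latticeAnnihilator_torusAnnihilator`), the order of `Γ` is
the index of the lattice, and everything commutes with permutations of the coordinates.

For the rest, Burnside's lemma gives `24 f(n) = a(n) + g(n)` (`tetraCount_mul`), where `a(n)` is the
number of all sublattices of index `n` of `ℤ³` and `g(n)` counts, with multiplicity, those fixed by
some nontrivial permutation. A subgroup of `ℤ × Q` consists of an integer `d`, a subgroup `B` of `Q`
and a gluing homomorphism `B → ℤ/d`, and its index is `d [Q : B]` (`glue_bijective`,
`index_gluedSubgroup`). If `Q` is free of rank `k` there are `d ^ k` gluing maps, so that the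
Dirichlet series of `a` is `ζ(s) ζ(s - 1) ζ(s - 2)`.

Every nontrivial permutation has a power conjugate to a transposition, a double transposition or a
three-cycle, and each of these preserves a line in the lattice on which it acts by a scalar that is
not an eigenvalue of its action on the quotient by the line. An invariant sublattice is then
determined by `d` and `B` up to at most 36 choices of the gluing map (`card_invariant_gluings_le`).
So `g(n)` is at most a constant times the coefficient of `ζ(s) ζ(s) ζ(s - 1)`, and its Dirichlet
series converges absolutely for `Re s > 2`. The pole at `3` therefore comes from `ζ(s - 2)` alone.

For the partial sums, `a(n)` is summed over the index `b` of the projection to `ℤ²`; after division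
by `N³` the sum over `b` converges by dominated convergence to `ζ(2) ζ(3) / 3`, while `g`
contributes `o(N³)`, because `∑ g(n) n⁻³` converges.
-/

/-! ### Duality between sublattices and finite subgroups of the torus -/

section Duality

variable {ι : Type*} [Fintype ι]

/-- The point `z` of the torus `(ℂˣ)^ι`, as a character of the lattice `ℤ^ι`: it sends `x` to
`∏ i, z i ^ x i`. -/
def torusChar (z : ι → ℂˣ) : (ι → ℤ) →+ Additive ℂˣ where
  toFun x := Additive.ofMul (∏ i, z i ^ x i)
  map_zero' := by simp
  map_add' x y := by
    simp only [Pi.add_apply, zpow_add, Finset.prod_mul_distrib]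
    rfl

/-- The subgroup of the torus on which all characters in `B` are trivial. -/
def torusAnnihilator (B : AddSubgroup (ι → ℤ)) : Subgroup (ι → ℂˣ) where
  carrier := {z | ∀ x ∈ B, ∏ i, z i ^ x i = 1}
  one_mem' x _ := by simp
  mul_mem' {z w} hz hw x hx := by
    simp [mul_zpow, Finset.prod_mul_distrib, hz x hx, hw x hx]
  inv_mem' {z} hz x hx := by
    simp [hz x hx]

/-- The lattice of characters of the torus that are trivial on `Γ`. -/
def latticeAnnihilator (Γ : Subgroup (ι → ℂˣ)) : AddSubgroup (ι → ℤ) where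
  carrier := {x | ∀ z ∈ Γ, ∏ i, z i ^ x i = 1}
  zero_mem' z _ := by simp
  add_mem' {x y} hx hy z hz := by
    simp [zpow_add, Finset.prod_mul_distrib, hx z hz, hy z hz]
  neg_mem' {x} hx z hz := by
    simp [hx z hz]

theorem mem_latticeAnnihilator {Γ : Subgroup (ι → ℂˣ)} {x : ι → ℤ} :
    x ∈ latticeAnnihilator Γ ↔ ∀ z ∈ Γ, ∏ i, z i ^ x i = 1 := Iff.rfl

/-- The points of the annihilator of `B` are the characters of `ℤ^ι ⧸ B`. -/
noncomputable def torusAnnihilatorEquiv (B : AddSubgroup (ι → ℤ)) :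
    torusAnnihilator B ≃ (Multiplicative ((ι → ℤ) ⧸ B) →* ℂˣ) where
  toFun z := AddMonoidHom.toMultiplicativeLeft
    (QuotientAddGroup.lift B (torusChar z.1) fun x hx => z.2 x hx)
  invFun χ := ⟨fun i => by
      classical exact χ (.ofAdd (QuotientAddGroup.mk (Pi.single i 1))), by
    classical
    intro x hx
    have h : Multiplicative.ofAdd (QuotientAddGroup.mk x : (ι → ℤ) ⧸ B) =
        ∏ i, (Multiplicative.ofAdd (QuotientAddGroup.mk (Pi.single i 1) : (ι → ℤ) ⧸ B)) ^ x i := by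
      conv_lhs => rw [pi_eq_sum_univ' x]
      simp only [← QuotientAddGroup.mk'_apply, map_sum, ofAdd_sum, map_zsmul, ofAdd_zsmul]
    rw [← map_one χ, ← ofAdd_zero, ← (QuotientAddGroup.eq_zero_iff x).2 hx, h, map_prod]
    simp⟩
  left_inv z := by
    classical
    ext i : 2
    change ∏ j, z.1 j ^ (Pi.single i (1 : ℤ) : ι → ℤ) j = z.1 i
    rw [Finset.prod_eq_single i] <;> simp +contextual
  right_inv χ := by
    classical
    apply AddMonoidHom.toMultiplicativeLeft.symm.injective
    ext x
    simp [torusChar, Pi.single_apply]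

/-- A lattice of finite index has an annihilator of that order. -/
theorem card_torusAnnihilator (B : AddSubgroup (ι → ℤ)) (hB : B.index ≠ 0) :
    Nat.card (torusAnnihilator B) = B.index := by
  have : B.FiniteIndex := ⟨hB⟩
  have : Finite (Multiplicative ((ι → ℤ) ⧸ B)) := inferInstanceAs (Finite ((ι → ℤ) ⧸ B))
  rw [Nat.card_congr (torusAnnihilatorEquiv B), CommGroup.card_monoidHom_of_hasEnoughRootsOfUnity]
  rfl

/-- The characters of the finite group `ℤ^ι ⧸ B` separate its points. -/
theorem latticeAnnihilator_torusAnnihilator (B : AddSubgroup (ι → ℤ)) (hB : B.index ≠ 0) :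
    latticeAnnihilator (torusAnnihilator B) = B := by
  have : B.FiniteIndex := ⟨hB⟩
  have : Finite (Multiplicative ((ι → ℤ) ⧸ B)) := inferInstanceAs (Finite ((ι → ℤ) ⧸ B))
  refine le_antisymm (fun x hx => ?_) fun x hx z hz => hz x hx
  by_contra hxB
  have hne : Multiplicative.ofAdd (x : (ι → ℤ) ⧸ B) ≠ 1 := fun h =>
    hxB ((QuotientAddGroup.eq_zero_iff x).1 h)
  obtain ⟨χ, hχ⟩ := CommGroup.exists_apply_ne_one_of_hasEnoughRootsOfUnity _ ℂ hne
  obtain ⟨z, rfl⟩ := (torusAnnihilatorEquiv B).surjective χ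
  exact hχ (hx z.1 z.2)

/-- `ℤ^ι` modulo the annihilator of `Γ` embeds into the character group of `Γ`. -/
theorem latticeAnnihilator_index_ne_zero_and_le (Γ : Subgroup (ι → ℂˣ)) [Finite Γ] :
    (latticeAnnihilator Γ).index ≠ 0 ∧ (latticeAnnihilator Γ).index ≤ Nat.card Γ := by
  let f : Multiplicative (ι → ℤ) →* (Γ →* ℂˣ) :=
    { toFun := fun x =>
        { toFun := fun z => ∏ i, z.1 i ^ x.toAdd i
          map_one' := by simp
          map_mul' := fun z w => by simp [mul_zpow, Finset.prod_mul_distrib] }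
      map_one' := by
        ext z
        simp
      map_mul' := fun x y => by
        ext z
        simp [zpow_add, Finset.prod_mul_distrib] }
  have hf : f.ker = (latticeAnnihilator Γ).toSubgroup := by
    ext x
    exact ⟨fun h z hz => DFunLike.congr_fun h ⟨z, hz⟩, fun h => MonoidHom.ext fun z => h z.1 z.2⟩
  have hc : Nat.card (Γ →* ℂˣ) = Nat.card Γ :=
    CommGroup.card_monoidHom_of_hasEnoughRootsOfUnity Γ ℂ
  have : Finite (Γ →* ℂˣ) := Nat.finite_of_card_ne_zero (hc ▸ Nat.card_pos.ne')
  have hk : (latticeAnnihilator Γ).index = Nat.card f.range := by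
    rw [← Subgroup.index_ker, hf]
    rfl
  rw [hk]
  exact ⟨Nat.card_pos.ne', hc ▸ Nat.card_le_card_of_injective _ Subtype.val_injective⟩

/-- The double annihilator contains `Γ`, and its order, the index of the annihilator, is at most
that of `Γ`. -/
theorem torusAnnihilator_latticeAnnihilator (Γ : Subgroup (ι → ℂˣ)) [Finite Γ] :
    torusAnnihilator (latticeAnnihilator Γ) = Γ := by
  obtain ⟨h0, hle⟩ := latticeAnnihilator_index_ne_zero_and_le Γ
  have hcard := card_torusAnnihilator _ h0
  have : Finite (torusAnnihilator (latticeAnnihilator Γ)) :=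
    Nat.finite_of_card_ne_zero (hcard ▸ h0)
  exact (Subgroup.eq_of_le_of_card_ge (fun z hz x hx => hx z hz) (hcard ▸ hle)).symm

theorem latticeAnnihilator_index (Γ : Subgroup (ι → ℂˣ)) [Finite Γ] :
    (latticeAnnihilator Γ).index = Nat.card Γ := by
  rw [← card_torusAnnihilator _ (latticeAnnihilator_index_ne_zero_and_le Γ).1,
    torusAnnihilator_latticeAnnihilator]

end Duality

theorem latticeAnnihilator_map_permTorus (σ : Equiv.Perm (Fin 4)) (Γ : Subgroup (Fin 4 → ℂˣ)) :
    latticeAnnihilator (Γ.map (permTorus σ)) = (latticeAnnihilator Γ).map (permZ4 σ) := by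
  have key (z : Fin 4 → ℂˣ) (x : Fin 4 → ℤ) :
      ∏ i, permTorus σ z i ^ x i = ∏ i, z i ^ x (σ i) := by
    rw [← Equiv.prod_comp σ]
    simp [permTorus]
  ext x
  simp only [mem_latticeAnnihilator, Subgroup.mem_map, forall_exists_index, and_imp,
    forall_apply_eq_imp_iff₂, key, AddSubgroup.mem_map]
  refine ⟨fun h => ⟨fun i => x (σ i), h, by ext i; simp [permZ4]⟩, ?_⟩
  rintro ⟨y, hy, rfl⟩ z hz
  simpa [permZ4] using hy z hz

theorem zmultiples_le_latticeAnnihilator {n : ℕ} (Γ : OrbifoldGroup n) :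
    AddSubgroup.zmultiples (fun _ : Fin 4 => (1 : ℤ)) ≤ latticeAnnihilator Γ.1 := by
  rw [AddSubgroup.zmultiples_le]
  intro z hz
  simpa using Γ.2.1 z hz

/-- The annihilator of an orbifold group, as a sublattice of the tetrahedral lattice: the
determinant condition says that `(1, 1, 1, 1)` annihilates the group. -/
noncomputable def orbifoldSublattice {n : ℕ} (hn : 0 < n) (Γ : OrbifoldGroup n) :
    TetraSublattice n :=
  ⟨(latticeAnnihilator Γ.1).map (QuotientAddGroup.mk' _), by
    have : Finite Γ.1 := Nat.finite_of_card_ne_zero (Γ.2.2.trans_ne hn.ne')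
    rw [AddSubgroup.index_map_eq _ (QuotientAddGroup.mk'_surjective _)
      (by simpa using zmultiples_le_latticeAnnihilator Γ), latticeAnnihilator_index, Γ.2.2]⟩

theorem orbifoldSublattice_bijective {n : ℕ} (hn : 0 < n) :
    Function.Bijective (orbifoldSublattice hn) := by
  constructor
  · intro Γ Δ h
    have hΓ : Finite Γ.1 := Nat.finite_of_card_ne_zero (Γ.2.2.trans_ne hn.ne')
    have hΔ : Finite Δ.1 := Nat.finite_of_card_ne_zero (Δ.2.2.trans_ne hn.ne')
    have h1 := congrArg (AddSubgroup.comap (QuotientAddGroup.mk' _)) (congrArg Subtype.val h)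
    simp only [orbifoldSublattice] at h1
    rw [AddSubgroup.comap_map_eq_self (by simpa using zmultiples_le_latticeAnnihilator Γ),
      AddSubgroup.comap_map_eq_self (by simpa using zmultiples_le_latticeAnnihilator Δ)] at h1
    apply Subtype.ext
    rw [← torusAnnihilator_latticeAnnihilator Γ.1, h1, torusAnnihilator_latticeAnnihilator]
  · intro A
    have hindex : (A.1.comap (QuotientAddGroup.mk' _)).index = n := by
      rw [AddSubgroup.index_comap_of_surjective _ (QuotientAddGroup.mk'_surjective _), A.2]
    have h0 : (A.1.comap (QuotientAddGroup.mk' _)).index ≠ 0 := hindex.trans_ne hn.ne'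
    refine ⟨⟨torusAnnihilator (A.1.comap (QuotientAddGroup.mk' _)), fun z hz => ?_, ?_⟩, ?_⟩
    · have h1 : (fun _ => 1 : Fin 4 → ℤ) ∈ A.1.comap (QuotientAddGroup.mk' _) := by
        have : ((fun _ => 1 : Fin 4 → ℤ) : TetraLattice) = 0 :=
          (QuotientAddGroup.eq_zero_iff _).2 (AddSubgroup.mem_zmultiples _)
        rw [AddSubgroup.mem_comap, QuotientAddGroup.mk'_apply, this]
        exact A.1.zero_mem
      simpa using hz _ h1
    · rw [card_torusAnnihilator _ h0, hindex]
    · apply Subtype.ext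
      simp only [orbifoldSublattice]
      rw [latticeAnnihilator_torusAnnihilator _ h0,
        AddSubgroup.map_comap_eq_self_of_surjective (QuotientAddGroup.mk'_surjective _)]

theorem orbifoldSublattice_map {n : ℕ} (hn : 0 < n) {Γ Δ : OrbifoldGroup n}
    {σ : Equiv.Perm (Fin 4)} (h : Γ.1.map (permTorus σ) = Δ.1) :
    (orbifoldSublattice hn Γ).1.map (tetraPerm σ) = (orbifoldSublattice hn Δ).1 := by
  simp only [orbifoldSublattice]
  rw [← h, latticeAnnihilator_map_permTorus, AddSubgroup.map_map, AddSubgroup.map_map]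
  rfl

theorem abelianOrbifoldCount_eq_tetraCount {n : ℕ} (hn : 0 < n) :
    abelianOrbifoldCount n = tetraCount n := by
  refine Nat.card_congr (Quotient.congr (Equiv.ofBijective _ (orbifoldSublattice_bijective hn))
    fun Γ Δ => ⟨?_, ?_⟩)
  · rintro ⟨σ, h⟩
    exact ⟨σ, orbifoldSublattice_map hn h⟩
  · rintro ⟨σ, h⟩
    refine ⟨σ, ?_⟩
    have hinj : Function.Injective (permTorus σ) := fun z w hzw => by
      ext i
      simpa [permTorus] using congrArg Units.val (congrFun hzw (σ i))
    -- the translate of `Γ` by `σ` has the same annihilator in the tetrahedral lattice as `Δ`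
    let Γ' : OrbifoldGroup n := ⟨Γ.1.map (permTorus σ), by
      rintro _ ⟨z, hz, rfl⟩
      rw [← Γ.2.1 z hz]
      exact Equiv.prod_comp σ.symm z, 
      (Nat.card_congr (Γ.1.equivMapOfInjective _ hinj).toEquiv).symm.trans Γ.2.2⟩
    have : Γ' = Δ := (orbifoldSublattice_bijective hn).1
      (Subtype.ext ((orbifoldSublattice_map hn (Γ := Γ) (Δ := Γ') rfl).symm.trans h))
    exact congrArg Subtype.val this

/-! ### Subgroups of `ℤ × Q` -/

section ProdInt

variable {Q : Type*} [AddCommGroup Q]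

/-- The subgroup of `ℤ × Q` with intersection `dℤ` with `ℤ`, with projection `B` to `Q`, and whose
fibre above `q ∈ B` is the residue class `φ q` modulo `d`. Every subgroup of `ℤ × Q` is of this
form. -/
def gluedSubgroup (d : ℕ) (B : AddSubgroup Q) (φ : B →+ ZMod d) : AddSubgroup (ℤ × Q) where
  carrier := {x | ∃ h : x.2 ∈ B, φ ⟨x.2, h⟩ = (x.1 : ZMod d)}
  zero_mem' := ⟨B.zero_mem, (map_zero φ).trans (by simp)⟩
  add_mem' := by
    rintro x y ⟨hx, hx'⟩ ⟨hy, hy'⟩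
    refine ⟨B.add_mem hx hy, ?_⟩
    rw [Prod.fst_add, Int.cast_add, ← hx', ← hy', ← map_add]
    rfl
  neg_mem' := by
    rintro x ⟨hx, hx'⟩
    refine ⟨B.neg_mem hx, ?_⟩
    rw [Prod.fst_neg, Int.cast_neg, ← hx', ← map_neg]
    rfl

theorem mk_mem_gluedSubgroup {d : ℕ} {B : AddSubgroup Q} {φ : B →+ ZMod d} {m : ℤ} {q : B} :
    (m, (q : Q)) ∈ gluedSubgroup d B φ ↔ φ q = (m : ZMod d) :=
  ⟨fun h => h.2, fun h => ⟨q.2, h⟩⟩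

/-- Inside the preimage of `B`, which has index `[Q : B]`, the glued subgroup is the kernel of the
surjection `(m, q) ↦ φ q - m` to `ZMod d`. Both sides are `0` if `d = 0` or `B` has infinite
index. -/
theorem index_gluedSubgroup (d : ℕ) (B : AddSubgroup Q) (φ : B →+ ZMod d) :
    (gluedSubgroup d B φ).index = d * B.index := by
  have hle : gluedSubgroup d B φ ≤ B.comap (AddMonoidHom.snd ℤ Q) := fun x hx => hx.1
  rw [← AddSubgroup.relIndex_mul_index hle,
    AddSubgroup.index_comap_of_surjective _ Prod.snd_surjective]
  congr 1
  let f : B.comap (AddMonoidHom.snd ℤ Q) →+ ZMod d :=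
    φ.comp ((AddMonoidHom.snd ℤ Q).addSubgroupComap B) -
      (Int.castAddHom (ZMod d)).comp ((AddMonoidHom.fst ℤ Q).comp (AddSubgroup.subtype _))
  have hker : (gluedSubgroup d B φ).addSubgroupOf (B.comap (AddMonoidHom.snd ℤ Q)) = f.ker := by
    ext x
    rw [AddMonoidHom.mem_ker, AddSubgroup.mem_addSubgroupOf]
    refine ⟨fun h => sub_eq_zero.2 h.2, fun h => ⟨x.2, sub_eq_zero.1 h⟩⟩
  have hsurj : Function.Surjective f := fun m => by
    obtain ⟨k, rfl⟩ := ZMod.intCast_surjective m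
    refine ⟨⟨(-k, 0), B.zero_mem⟩, ?_⟩
    have h0 : φ ⟨0, B.zero_mem⟩ = 0 := map_zero φ
    change φ ⟨0, _⟩ - ((-k : ℤ) : ZMod d) = k
    rw [h0]
    simp
  rw [AddSubgroup.relIndex, hker, AddSubgroup.index_ker, AddMonoidHom.range_eq_top.2 hsurj,
    Nat.card_congr AddSubgroup.topEquiv.toEquiv, Nat.card_zmod]

theorem le_of_gluedSubgroup_eq {d e : ℕ} {B C : AddSubgroup Q} {φ : B →+ ZMod d} {ψ : C →+ ZMod e}
    (h : gluedSubgroup d B φ = gluedSubgroup e C ψ) : B ≤ C := fun q hq => by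
  obtain ⟨m, hm⟩ := ZMod.intCast_surjective (φ ⟨q, hq⟩)
  have : (m, q) ∈ gluedSubgroup d B φ := ⟨hq, hm.symm⟩
  rw [h] at this
  exact this.1

theorem dvd_of_gluedSubgroup_eq {d e : ℕ} {B C : AddSubgroup Q} {φ : B →+ ZMod d} {ψ : C →+ ZMod e}
    (h : gluedSubgroup d B φ = gluedSubgroup e C ψ) : e ∣ d := by
  have : ((d : ℤ), (0 : Q)) ∈ gluedSubgroup d B φ :=
    ⟨B.zero_mem, (map_zero φ).trans (by simp)⟩
  rw [h] at this
  obtain ⟨h0, h1⟩ := this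
  have h2 : ψ ⟨0, h0⟩ = 0 := map_zero ψ
  simp only [h2, Int.cast_natCast] at h1
  exact (ZMod.natCast_eq_zero_iff _ _).1 h1.symm

theorem gluedSubgroup_injective (d : ℕ) (B : AddSubgroup Q) :
    Function.Injective (gluedSubgroup d B) := fun φ ψ h => by
  ext q
  obtain ⟨m, hm⟩ := ZMod.intCast_surjective (φ q)
  have := mk_mem_gluedSubgroup.2 hm.symm
  rw [h] at this
  rw [mk_mem_gluedSubgroup.1 this, hm]

/-- The gluing map sends the projection of `(m, q) ∈ A` to the class of `m`, which is well defined
modulo the generator `a` of the intersection of `A` with `ℤ`. -/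
theorem exists_eq_gluedSubgroup (A : AddSubgroup (ℤ × Q)) :
    ∃ (d : ℕ) (B : AddSubgroup Q) (φ : B →+ ZMod d), A = gluedSubgroup d B φ := by
  obtain ⟨a, ha⟩ := Int.subgroup_cyclic (A.comap (AddMonoidHom.inl ℤ Q))
  have hmem (m : ℤ) : (m, (0 : Q)) ∈ A ↔ (m : ZMod a.natAbs) = 0 := by
    rw [ZMod.intCast_zmod_eq_zero_iff_dvd, Int.natCast_natAbs, abs_dvd, ← Int.mem_zmultiples_iff,
      AddSubgroup.zmultiples_eq_closure, ← ha]
    rfl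
  let p : A →+ A.map (AddMonoidHom.snd ℤ Q) := (AddMonoidHom.snd ℤ Q).addSubgroupMap A
  have hp : Function.Surjective p := (AddMonoidHom.snd ℤ Q).addSubgroupMap_surjective A
  let g : A →+ ZMod a.natAbs :=
    (Int.castAddHom _).comp ((AddMonoidHom.fst ℤ Q).comp A.subtype)
  have hle : p.ker ≤ g.ker := by
    rintro ⟨⟨m, q⟩, hx⟩ h
    have hq : q = 0 := congrArg Subtype.val h
    subst hq
    exact (hmem m).1 hx
  let φ := p.liftOfSurjective hp ⟨g, hle⟩
  have hφ (x : A) : φ (p x) = (x.1.1 : ZMod a.natAbs) :=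
    p.liftOfRightInverse_comp_apply _ (Function.rightInverse_surjInv hp) ⟨g, hle⟩ x
  refine ⟨a.natAbs, A.map (AddMonoidHom.snd ℤ Q), φ, ?_⟩
  ext ⟨m, q⟩
  constructor
  · intro hx
    exact ⟨⟨_, hx, rfl⟩, hφ ⟨_, hx⟩⟩
  · rintro ⟨⟨⟨m', q'⟩, hx, hq : q' = q⟩, h⟩
    subst hq
    have h1 : (m' : ZMod a.natAbs) = m := (hφ ⟨_, hx⟩).symm.trans h
    have h2 : (m - m', (0 : Q)) ∈ A := (hmem _).2 (by simp [h1])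
    simpa using A.add_mem h2 hx

/-- The subgroups of index `n` of an abelian group. -/
abbrev SubgroupsOfIndex (Q : Type*) [AddCommGroup Q] (n : ℕ) : Type _ :=
  {A : AddSubgroup Q // A.index = n}

/-- The subgroups of index `n` of `ℤ × Q` with property `P`, from their gluing data. -/
def glue (P : AddSubgroup (ℤ × Q) → Prop) (n : ℕ)
    (t : Σ p : n.divisorsAntidiagonal, Σ B : SubgroupsOfIndex Q p.1.2,
      {φ : B.1 →+ ZMod p.1.1 // P (gluedSubgroup p.1.1 B.1 φ)}) :
    {A : SubgroupsOfIndex (ℤ × Q) n // P A.1} :=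
  ⟨⟨gluedSubgroup t.1.1.1 t.2.1.1 t.2.2.1, by
    rw [index_gluedSubgroup, t.2.1.2, (Nat.mem_divisorsAntidiagonal.1 t.1.2).1]⟩, t.2.2.2⟩

theorem glue_bijective (P : AddSubgroup (ℤ × Q) → Prop) {n : ℕ} (hn : n ≠ 0) :
    Function.Bijective (glue P n) := by
  constructor
  · rintro ⟨⟨⟨d, b⟩, hp⟩, ⟨B, hB⟩, φ, hφ⟩ ⟨⟨⟨e, c⟩, hq⟩, ⟨C, hC⟩, ψ, hψ⟩ h
    have h : gluedSubgroup d B φ = gluedSubgroup e C ψ :=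
      congrArg (fun A => A.1.1) h
    obtain rfl : d = e :=
      Nat.dvd_antisymm (dvd_of_gluedSubgroup_eq h.symm) (dvd_of_gluedSubgroup_eq h)
    obtain rfl : B = C := le_antisymm (le_of_gluedSubgroup_eq h) (le_of_gluedSubgroup_eq h.symm)
    obtain rfl : b = c := hB.symm.trans hC
    obtain rfl : φ = ψ := gluedSubgroup_injective d B h
    rfl
  · rintro ⟨⟨A, hA⟩, hP⟩
    obtain ⟨d, B, φ, rfl⟩ := exists_eq_gluedSubgroup A
    exact ⟨⟨⟨(d, B.index), Nat.mem_divisorsAntidiagonal.2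
      ⟨(index_gluedSubgroup d B φ).symm.trans hA, hn⟩⟩, ⟨B, rfl⟩, φ, hP⟩, rfl⟩

/-- Homomorphisms from a free abelian group correspond to the tuples of their values on a basis. -/
noncomputable def homEquivOfFree (B M : Type*) [AddCommGroup B] [AddCommGroup M] [Module.Free ℤ B]
    [Module.Finite ℤ B] : (B →+ M) ≃ (Fin (Module.finrank ℤ B) → M) :=
  (addMonoidHomLequivInt ℤ).toEquiv.trans ((Module.finBasis ℤ B).constr ℤ).toEquiv.symm

variable [Module.Free ℤ Q] [Module.Finite ℤ Q]

theorem card_addMonoidHom_zmod (B : AddSubgroup Q) (hB : B.index ≠ 0) (d : ℕ) :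
    Nat.card (B →+ ZMod d) = d ^ Module.finrank ℤ Q := by
  have : B.FiniteIndex := ⟨hB⟩
  have : Module.Free ℤ B := inferInstanceAs (Module.Free ℤ B.toIntSubmodule)
  have : Module.Finite ℤ B := inferInstanceAs (Module.Finite ℤ B.toIntSubmodule)
  rw [Nat.card_congr (homEquivOfFree B (ZMod d)), Nat.card_fun, Nat.card_zmod, Nat.card_fin,
    AddSubgroup.finrank_eq_of_finiteIndex]

theorem finite_addMonoidHom_zmod (B : AddSubgroup Q) (hB : B.index ≠ 0) {d : ℕ} (hd : d ≠ 0) :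
    Finite (B →+ ZMod d) :=
  Nat.finite_of_card_ne_zero (by rw [card_addMonoidHom_zmod B hB]; exact pow_ne_zero _ hd)

/-- In `ZMod d` at most `k` elements are killed by `k`, so a subgroup of finite index has at most
`k ^ rank` homomorphisms to `ZMod d` that are killed by `k`. -/
theorem card_addMonoidHom_nsmul_eq_zero_le (B : AddSubgroup Q) (hB : B.index ≠ 0) {d k : ℕ}
    (hd : d ≠ 0) (hk : 0 < k) :
    Nat.card {χ : B →+ ZMod d // k • χ = 0} ≤ k ^ Module.finrank ℤ Q := by
  classical
  have : B.FiniteIndex := ⟨hB⟩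
  have : Module.Free ℤ B := inferInstanceAs (Module.Free ℤ B.toIntSubmodule)
  have : Module.Finite ℤ B := inferInstanceAs (Module.Finite ℤ B.toIntSubmodule)
  have : NeZero d := ⟨hd⟩
  have hcard : Nat.card {m : ZMod d // k • m = 0} ≤ k := by
    rw [Nat.card_eq_fintype_card, Fintype.card_subtype]
    exact IsAddCyclic.card_nsmul_eq_zero_le hk
  let b := Module.finBasis ℤ B
  calc Nat.card {χ : B →+ ZMod d // k • χ = 0}
      ≤ Nat.card (Fin (Module.finrank ℤ B) → {m : ZMod d // k • m = 0}) := by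
        refine Nat.card_le_card_of_injective
          (fun χ i => ⟨χ.1 (b i), DFunLike.congr_fun χ.2 (b i)⟩) fun χ ψ h => ?_
        apply Subtype.ext
        apply AddMonoidHom.toIntLinearMap_injective
        exact b.ext fun i => congrArg Subtype.val (congrFun h i)
    _ ≤ k ^ Module.finrank ℤ Q := by
        rw [Nat.card_fun, Nat.card_fin, AddSubgroup.finrank_eq_of_finiteIndex]
        exact Nat.pow_le_pow_left hcard _

/-- The number of subgroups of index `n`; it is `0` if there are infinitely many. -/
noncomputable def sublatticeCount (Q : Type*) [AddCommGroup Q] (n : ℕ) : ℕ :=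
  Nat.card (SubgroupsOfIndex Q n)

theorem finite_subgroupsOfIndex_prod (hfin : ∀ m ≠ 0, Finite (SubgroupsOfIndex Q m))
    {n : ℕ} (hn : n ≠ 0) :
    Finite (SubgroupsOfIndex (ℤ × Q) n) := by
  have (p : n.divisorsAntidiagonal) : Finite (SubgroupsOfIndex Q p.1.2) :=
    hfin _ (Nat.ne_zero_of_mem_divisorsAntidiagonal p.2).2
  have (p : n.divisorsAntidiagonal) (B : SubgroupsOfIndex Q p.1.2) :
      Finite (B.1 →+ ZMod p.1.1) :=
    finite_addMonoidHom_zmod _ (B.2.trans_ne (Nat.ne_zero_of_mem_divisorsAntidiagonal p.2).2)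
      (Nat.ne_zero_of_mem_divisorsAntidiagonal p.2).1
  have := Finite.of_surjective _ (glue_bijective (Q := Q) (fun _ => True) hn).2
  exact Finite.of_injective (β := {A : SubgroupsOfIndex (ℤ × Q) n // True})
    (fun A => ⟨A, trivial⟩) fun A B h => congrArg Subtype.val h

/-- The count of subgroups with a property `P`, sorted by `d` and by the projection `B` to `Q`. The
inner sum is over a finite set because `p.1.2` is not zero. -/
theorem card_subgroupsOfIndex_prod (hfin : ∀ m ≠ 0, Finite (SubgroupsOfIndex Q m))
    (P : AddSubgroup (ℤ × Q) → Prop) {n : ℕ} (hn : n ≠ 0) :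
    Nat.card {A : SubgroupsOfIndex (ℤ × Q) n // P A.1} =
      ∑ p : n.divisorsAntidiagonal, ∑ᶠ B : SubgroupsOfIndex Q p.1.2,
        Nat.card {φ : B.1 →+ ZMod p.1.1 // P (gluedSubgroup p.1.1 B.1 φ)} := by
  have (p : n.divisorsAntidiagonal) : Finite (SubgroupsOfIndex Q p.1.2) :=
    hfin _ (Nat.ne_zero_of_mem_divisorsAntidiagonal p.2).2
  have (p : n.divisorsAntidiagonal) (B : SubgroupsOfIndex Q p.1.2) :
      Finite (B.1 →+ ZMod p.1.1) :=
    finite_addMonoidHom_zmod _ (B.2.trans_ne (Nat.ne_zero_of_mem_divisorsAntidiagonal p.2).2)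
      (Nat.ne_zero_of_mem_divisorsAntidiagonal p.2).1
  rw [← Nat.card_eq_of_bijective _ (glue_bijective P hn), Nat.card_sigma]
  refine Finset.sum_congr rfl fun p _ => ?_
  have := Fintype.ofFinite (SubgroupsOfIndex Q p.1.2)
  rw [Nat.card_sigma, finsum_eq_sum_of_fintype]

theorem sublatticeCount_prod (hfin : ∀ m ≠ 0, Finite (SubgroupsOfIndex Q m))
    {n : ℕ} (hn : n ≠ 0) :
    sublatticeCount (ℤ × Q) n =
      ∑ p ∈ n.divisorsAntidiagonal, p.1 ^ Module.finrank ℤ Q * sublatticeCount Q p.2 := by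
  have h := card_subgroupsOfIndex_prod hfin (fun _ => True) hn
  rw [sublatticeCount, ← Nat.card_congr (Equiv.subtypeUnivEquiv fun _ => trivial), h,
    ← Finset.sum_coe_sort n.divisorsAntidiagonal
      fun p => p.1 ^ Module.finrank ℤ Q * sublatticeCount Q p.2]
  refine Finset.sum_congr rfl fun p _ => ?_
  have : Finite (SubgroupsOfIndex Q p.1.2) :=
    hfin _ (Nat.ne_zero_of_mem_divisorsAntidiagonal p.2).2
  have := Fintype.ofFinite (SubgroupsOfIndex Q p.1.2)
  have (B : SubgroupsOfIndex Q p.1.2) :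
      Nat.card {_φ : B.1 →+ ZMod p.1.1 // True} = p.1.1 ^ Module.finrank ℤ Q := by
    rw [Nat.card_congr (Equiv.subtypeUnivEquiv fun _ => trivial), card_addMonoidHom_zmod _
      (B.2.trans_ne (Nat.ne_zero_of_mem_divisorsAntidiagonal p.2).2)]
  rw [finsum_eq_sum_of_fintype, Finset.sum_congr rfl fun B _ => this B, Finset.sum_const,
    Finset.card_univ, sublatticeCount, Nat.card_eq_fintype_card, smul_eq_mul, mul_comm]

theorem card_subgroupsOfIndex_prod_le (hfin : ∀ m ≠ 0, Finite (SubgroupsOfIndex Q m))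
    (P : AddSubgroup (ℤ × Q) → Prop) (C : ℕ)
    (hC : ∀ (d : ℕ) (B : AddSubgroup Q), d ≠ 0 → B.index ≠ 0 →
      Nat.card {φ : B →+ ZMod d // P (gluedSubgroup d B φ)} ≤ C) {n : ℕ} (hn : n ≠ 0) :
    Nat.card {A : SubgroupsOfIndex (ℤ × Q) n // P A.1} ≤
      C * ∑ p ∈ n.divisorsAntidiagonal, sublatticeCount Q p.2 := by
  rw [card_subgroupsOfIndex_prod hfin P hn, Finset.mul_sum,
    ← Finset.sum_coe_sort n.divisorsAntidiagonal fun p => C * sublatticeCount Q p.2]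
  refine Finset.sum_le_sum fun p _ => ?_
  have : Finite (SubgroupsOfIndex Q p.1.2) :=
    hfin _ (Nat.ne_zero_of_mem_divisorsAntidiagonal p.2).2
  have := Fintype.ofFinite (SubgroupsOfIndex Q p.1.2)
  rw [finsum_eq_sum_of_fintype]
  refine (Finset.sum_le_card_nsmul _ _ C fun B _ => hC _ _
    (Nat.ne_zero_of_mem_divisorsAntidiagonal p.2).1
    (B.2.trans_ne (Nat.ne_zero_of_mem_divisorsAntidiagonal p.2).2)).trans ?_
  rw [Finset.card_univ, sublatticeCount, Nat.card_eq_fintype_card, smul_eq_mul, mul_comm]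

end ProdInt

theorem addSubgroup_int_eq_zmultiples_index (A : AddSubgroup ℤ) :
    A = AddSubgroup.zmultiples (A.index : ℤ) := by
  obtain ⟨a, rfl⟩ := Int.subgroup_cyclic A
  rw [← AddSubgroup.zmultiples_eq_closure, Int.index_zmultiples, Int.zmultiples_natAbs]

theorem sublatticeCount_int (n : ℕ) : sublatticeCount ℤ n = 1 := by
  rw [sublatticeCount, Nat.card_eq_one_iff_unique]
  refine ⟨⟨fun A B => Subtype.ext ?_⟩, ⟨AddSubgroup.zmultiples (n : ℤ), by simp⟩⟩
  rw [addSubgroup_int_eq_zmultiples_index A.1, addSubgroup_int_eq_zmultiples_index B.1, A.2, B.2]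

theorem finite_subgroupsOfIndex_int (n : ℕ) : Finite (SubgroupsOfIndex ℤ n) :=
  Nat.finite_of_card_ne_zero ((sublatticeCount_int n).trans_ne one_ne_zero)

theorem finite_subgroupsOfIndex_int_sq {n : ℕ} (hn : n ≠ 0) :
    Finite (SubgroupsOfIndex (ℤ × ℤ) n) :=
  finite_subgroupsOfIndex_prod (fun m _ => finite_subgroupsOfIndex_int m) hn

theorem finite_subgroupsOfIndex_int_cube {n : ℕ} (hn : n ≠ 0) :
    Finite (SubgroupsOfIndex (ℤ × ℤ × ℤ) n) :=
  finite_subgroupsOfIndex_prod (fun _ => finite_subgroupsOfIndex_int_sq) hn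

theorem sublatticeCount_int_sq {n : ℕ} (hn : n ≠ 0) :
    sublatticeCount (ℤ × ℤ) n = ∑ p ∈ n.divisorsAntidiagonal, p.1 := by
  rw [sublatticeCount_prod (fun m _ => finite_subgroupsOfIndex_int m) hn]
  simp [sublatticeCount_int]

theorem sublatticeCount_int_cube {n : ℕ} (hn : n ≠ 0) :
    sublatticeCount (ℤ × ℤ × ℤ) n =
      ∑ p ∈ n.divisorsAntidiagonal, p.1 ^ 2 * sublatticeCount (ℤ × ℤ) p.2 := by
  rw [sublatticeCount_prod (fun _ => finite_subgroupsOfIndex_int_sq) hn]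
  simp

/-! ### Sublattices fixed by a symmetry -/

section Invariant

variable {Q : Type*} [AddCommGroup Q] [Module.Free ℤ Q] [Module.Finite ℤ Q]

/-- Let `T` be a self-map of `ℤ × Q` of the form `(m, q) ↦ (ε m + u q, τ q)`, as is every
endomorphism that preserves `ℤ`, and let `τ` be a root of the polynomial `a X² + b X + c`, whose
value at `ε` divides `6`. Two `T`-stable subgroups with the same intersection with `ℤ` and the same
projection to `Q` have gluing maps whose difference intertwines `τ` with `ε` and is therefore killed
by `6`. -/
theorem card_invariant_gluings_le (T : ℤ × Q → ℤ × Q) (ε : ℤ) (u : Q → ℤ) (τ : Q → Q)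
    (hT : ∀ x, T x = (ε * x.1 + u x.2, τ x.2)) (a b c m : ℤ)
    (hτ : ∀ q, a • τ (τ q) + b • τ q + c • q = 0) (hm : m * (a * ε ^ 2 + b * ε + c) = 6)
    (d : ℕ) (B : AddSubgroup Q) (hd : d ≠ 0) (hB : B.index ≠ 0) :
    Nat.card {φ : B →+ ZMod d // ∀ x ∈ gluedSubgroup d B φ, T x ∈ gluedSubgroup d B φ} ≤
      6 ^ Module.finrank ℤ Q := by
  rcases isEmpty_or_nonempty
    {φ : B →+ ZMod d // ∀ x ∈ gluedSubgroup d B φ, T x ∈ gluedSubgroup d B φ} with _ | ⟨φ₀, h₀⟩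
  · rw [Nat.card_of_isEmpty]
    exact Nat.zero_le _
  have key (φ : B →+ ZMod d) (hφ : ∀ x ∈ gluedSubgroup d B φ, T x ∈ gluedSubgroup d B φ) (q : B) :
      ∃ h : τ q ∈ B, φ ⟨τ q, h⟩ = ε * φ q + u q := by
    obtain ⟨k, hk⟩ := ZMod.intCast_surjective (φ q)
    have := hφ _ (mk_mem_gluedSubgroup.2 hk.symm)
    rw [hT] at this
    obtain ⟨h1, h2⟩ := this
    refine ⟨h1, h2.trans ?_⟩
    rw [← hk]
    push_cast
    rfl
  have hfin := finite_addMonoidHom_zmod B hB hd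
  refine le_trans ?_ (card_addMonoidHom_nsmul_eq_zero_le B hB hd (by norm_num : 0 < 6))
  refine Nat.card_le_card_of_injective (fun φ => ⟨φ.1 - φ₀, ?_⟩) fun φ ψ h =>
    Subtype.ext (sub_left_injective (congrArg Subtype.val h))
  obtain ⟨φ, hφ⟩ := φ
  have hχ (q : B) : ∃ h : τ q ∈ B, (φ - φ₀) ⟨τ q, h⟩ = ε * (φ - φ₀) q := by
    obtain ⟨h, h1⟩ := key φ hφ q
    obtain ⟨_, h2⟩ := key φ₀ h₀ q
    refine ⟨h, ?_⟩
    rw [AddMonoidHom.sub_apply, h1, h2, AddMonoidHom.sub_apply]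
    ring
  ext q
  obtain ⟨h1, e1⟩ := hχ q
  obtain ⟨h2, e2⟩ := hχ ⟨τ q, h1⟩
  have h0 : a • (⟨τ (τ q), h2⟩ : B) + b • (⟨τ q, h1⟩ : B) + c • q = 0 := Subtype.ext (hτ q)
  have e0 := congrArg (φ - φ₀) h0
  rw [map_zero, map_add, map_add, map_zsmul, map_zsmul, map_zsmul, e2, e1] at e0
  simp only [zsmul_eq_mul] at e0
  have hm' := congrArg (Int.cast : ℤ → ZMod d) hm
  push_cast at hm'
  simp only [AddMonoidHom.nsmul_apply, nsmul_eq_mul, AddMonoidHom.zero_apply]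
  push_cast
  rw [← hm']
  linear_combination (m : ZMod d) * e0

end Invariant

theorem tetraPerm_bijective (σ : Equiv.Perm (Fin 4)) : Function.Bijective (tetraPerm σ) := by
  have h (τ : Equiv.Perm (Fin 4)) : Function.LeftInverse (tetraPerm τ.symm) (tetraPerm τ) :=
    fun x => by
      have := DFunLike.congr_fun (tetraPerm_comp τ.symm τ) x
      rwa [Equiv.self_trans_symm, tetraPerm_refl] at this
  exact ⟨(h σ).injective, (h σ.symm).surjective⟩

instance tetraSublatticeMulAction (n : ℕ) :
    MulAction (Equiv.Perm (Fin 4)) (TetraSublattice n) where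
  smul σ A := ⟨A.1.map (tetraPerm σ), by
    rw [AddSubgroup.index_map_of_bijective (tetraPerm_bijective σ), A.2]⟩
  one_smul A := Subtype.ext (by
    change A.1.map (tetraPerm (Equiv.refl _)) = A.1
    rw [tetraPerm_refl, AddSubgroup.map_id])
  mul_smul σ τ A := Subtype.ext (by
    change A.1.map (tetraPerm (τ.trans σ)) = (A.1.map (tetraPerm τ)).map (tetraPerm σ)
    rw [AddSubgroup.map_map, tetraPerm_comp])

theorem sublatticeSetoid_eq_orbitRel (n : ℕ) :
    sublatticeSetoid n = MulAction.orbitRel (Equiv.Perm (Fin 4)) (TetraSublattice n) := by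
  ext A B
  rw [MulAction.orbitRel_apply, ← MulAction.mem_orbit_symm]
  exact exists_congr fun σ =>
    ⟨fun h => Subtype.ext h, fun h => congrArg Subtype.val h⟩

/-- The coordinates on the tetrahedral lattice with respect to the basis `v 0, v 1, v 2`. -/
def tetraCoord : TetraLattice ≃+ ℤ × ℤ × ℤ where
  toFun := QuotientAddGroup.lift _
    ({ toFun := fun x => (x 0 - x 3, x 1 - x 3, x 2 - x 3)
       map_zero' := by simp
       map_add' := fun x y => by
        simp only [Pi.add_apply, Prod.mk_add_mk, Prod.mk.injEq]
        refine ⟨?_, ?_, ?_⟩ <;> ring } : (Fin 4 → ℤ) →+ ℤ × ℤ × ℤ) (by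
      rw [AddSubgroup.zmultiples_le]
      simp [AddMonoidHom.mem_ker])
  invFun p := QuotientAddGroup.mk ![p.1, p.2.1, p.2.2, 0]
  left_inv x := by
    induction x using QuotientAddGroup.induction_on with | H x => ?_
    refine QuotientAddGroup.eq.2 (AddSubgroup.mem_zmultiples_iff.2 ⟨x 3, ?_⟩)
    ext i
    fin_cases i <;> simp
  right_inv p := by simp
  map_add' := map_add _

theorem tetraCoord_mk (x : Fin 4 → ℤ) :
    tetraCoord (x : TetraLattice) = (x 0 - x 3, x 1 - x 3, x 2 - x 3) := rfl

theorem tetraPerm_mk (σ : Equiv.Perm (Fin 4)) (x : Fin 4 → ℤ) :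
    tetraPerm σ (x : TetraLattice) = ((fun i => x (σ.symm i) : Fin 4 → ℤ) : TetraLattice) := rfl

instance finite_tetraSublattice (n : ℕ) [NeZero n] : Finite (TetraSublattice n) := by
  have := finite_subgroupsOfIndex_int_cube (NeZero.ne n)
  refine Finite.of_injective (β := SubgroupsOfIndex (ℤ × ℤ × ℤ) n) (fun A => ⟨A.1.map
    (tetraCoord : TetraLattice →+ ℤ × ℤ × ℤ), (AddSubgroup.index_map_equiv ..).trans A.2⟩)
    fun A B h => Subtype.ext ?_
  exact AddSubgroup.map_injective tetraCoord.injective (congrArg Subtype.val h)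

theorem card_tetraSublattice (n : ℕ) :
    Nat.card (TetraSublattice n) = sublatticeCount (ℤ × ℤ × ℤ) n := by
  refine Nat.card_congr (Equiv.subtypeEquiv tetraCoord.mapAddSubgroup.toEquiv fun A => ?_)
  exact (AddSubgroup.index_map_equiv A tetraCoord).symm ▸ Iff.rfl

/-- The number of sublattices of index `n` fixed by `σ`. -/
noncomputable def fixedCount (σ : Equiv.Perm (Fin 4)) (n : ℕ) : ℕ :=
  Nat.card (MulAction.fixedBy (TetraSublattice n) σ)

theorem fixedCount_one (n : ℕ) : fixedCount 1 n = sublatticeCount (ℤ × ℤ × ℤ) n := by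
  rw [fixedCount, MulAction.fixedBy_one_eq_univ, Nat.card_congr (Equiv.Set.univ _),
    card_tetraSublattice]

/-- Burnside's lemma for the tetrahedral group. -/
theorem sum_fixedCount (n : ℕ) (hn : n ≠ 0) : ∑ σ, fixedCount σ n = tetraCount n * 24 := by
  classical
  have : NeZero n := ⟨hn⟩
  have := Fintype.ofFinite (TetraSublattice n)
  have := MulAction.sum_card_fixedBy_eq_card_orbits_mul_card_group (Equiv.Perm (Fin 4))
    (TetraSublattice n)
  simp only [fixedCount, tetraCount, Nat.card_eq_fintype_card, sublatticeSetoid_eq_orbitRel]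
  rw [this, Fintype.card_perm]
  rfl

/-- A sublattice `A` fixed by `σ` is fixed by `σ ^ k`, and `τ • A` by the conjugate of `σ ^ k`. -/
theorem fixedCount_le_conj_pow (σ τ : Equiv.Perm (Fin 4)) (k n : ℕ) (hn : n ≠ 0) :
    fixedCount σ n ≤ fixedCount (τ * σ ^ k * τ⁻¹) n := by
  have : NeZero n := ⟨hn⟩
  refine Nat.card_le_card_of_injective (fun A => ⟨τ • A.1, ?_⟩) fun A B h =>
    Subtype.ext (MulAction.injective τ (congrArg Subtype.val h))
  have h1 : σ ^ k • A.1 = A.1 := MulAction.fixedBy_subset_fixedBy_zpow _ σ k A.2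
  rw [MulAction.mem_fixedBy, mul_smul, mul_smul, inv_smul_smul, h1]

/-- The bound for the sublattices fixed by `σ`, given coordinates `e` in which `σ` preserves the
first axis and acts on it and on the quotient as `card_invariant_gluings_le` demands. -/
theorem fixedCount_le_of_coord (σ : Equiv.Perm (Fin 4)) (e : TetraLattice ≃+ ℤ × ℤ × ℤ)
    (ε : ℤ) (u : ℤ × ℤ → ℤ) (τ : ℤ × ℤ → ℤ × ℤ)
    (hT : ∀ x, e (tetraPerm σ x) = (ε * (e x).1 + u (e x).2, τ (e x).2)) (a b c m : ℤ)
    (hτ : ∀ q, a • τ (τ q) + b • τ q + c • q = 0) (hm : m * (a * ε ^ 2 + b * ε + c) = 6)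
    (n : ℕ) (hn : n ≠ 0) :
    fixedCount σ n ≤ 36 * ∑ p ∈ n.divisorsAntidiagonal, sublatticeCount (ℤ × ℤ) p.2 := by
  have hfin := finite_subgroupsOfIndex_int_cube hn
  let T : ℤ × ℤ × ℤ → ℤ × ℤ × ℤ := fun x => (ε * x.1 + u x.2, τ x.2)
  refine le_trans ?_ (card_subgroupsOfIndex_prod_le (fun _ => finite_subgroupsOfIndex_int_sq)
    (fun A => ∀ x ∈ A, T x ∈ A) 36 (fun d B hd hB => ?_) hn)
  · refine Nat.card_le_card_of_injective (fun A => ⟨⟨A.1.1.map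
      (e : TetraLattice →+ ℤ × ℤ × ℤ), (AddSubgroup.index_map_equiv ..).trans A.1.2⟩, ?_⟩)
      fun A B h => Subtype.ext (Subtype.ext ?_)
    · rintro _ ⟨x, hx, rfl⟩
      refine ⟨tetraPerm σ x, ?_, hT x⟩
      have hA : A.1.1.map (tetraPerm σ) = A.1.1 := congrArg Subtype.val A.2
      rw [← hA]
      exact ⟨x, hx, rfl⟩
    · exact AddSubgroup.map_injective e.injective (congrArg (fun A => A.1.1) h)
  · have := card_invariant_gluings_le T ε u τ (fun _ => rfl) a b c m hτ hm d B hd hB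
    simpa using this

/-- For a transposition, the line is spanned by `v 0 - v 1`, on which it acts by `-1`; it acts
trivially on the quotient. -/
theorem fixedCount_swap_le (n : ℕ) (hn : n ≠ 0) : fixedCount (Equiv.swap 0 1) n ≤
    36 * ∑ p ∈ n.divisorsAntidiagonal, sublatticeCount (ℤ × ℤ) p.2 := by
  let f : ℤ × ℤ × ℤ ≃+ ℤ × ℤ × ℤ :=
    { toFun := fun x => (x.1, x.1 + x.2.1, x.2.2)
      invFun := fun x => (x.1, x.2.1 - x.1, x.2.2)
      left_inv := fun x => by simp
      right_inv := fun x => by simp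
      map_add' := fun x y => by
        ext <;> simp
        ring }
  refine fixedCount_le_of_coord _ (tetraCoord.trans f) (-1) (fun q => q.1) id (fun x => ?_)
    0 1 (-1) (-3) (fun q => by simp) (by norm_num) n hn
  induction x using QuotientAddGroup.induction_on with | H x => ?_
  rw [tetraPerm_mk, AddEquiv.trans_apply, AddEquiv.trans_apply, tetraCoord_mk, tetraCoord_mk,
    show (Equiv.swap 0 1 : Equiv.Perm (Fin 4)).symm 0 = 1 by decide,
    show (Equiv.swap 0 1 : Equiv.Perm (Fin 4)).symm 1 = 0 by decide,
    show (Equiv.swap 0 1 : Equiv.Perm (Fin 4)).symm 2 = 2 by decide,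
    show (Equiv.swap 0 1 : Equiv.Perm (Fin 4)).symm 3 = 3 by decide]
  ext <;> simp [f] <;> ring

/-- For a double transposition, the line is spanned by `v 0 + v 1`, which is fixed; it acts by `-1`
on the quotient. -/
theorem fixedCount_swap_mul_swap_le (n : ℕ) (hn : n ≠ 0) :
    fixedCount (Equiv.swap 0 1 * Equiv.swap 2 3) n ≤
    36 * ∑ p ∈ n.divisorsAntidiagonal, sublatticeCount (ℤ × ℤ) p.2 := by
  let f : ℤ × ℤ × ℤ ≃+ ℤ × ℤ × ℤ :=
    { toFun := fun x => (x.1, x.1 - x.2.1, x.2.2)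
      invFun := fun x => (x.1, x.1 - x.2.1, x.2.2)
      left_inv := fun x => by simp
      right_inv := fun x => by simp
      map_add' := fun x y => by
        ext <;> simp
        ring }
  refine fixedCount_le_of_coord _ (tetraCoord.trans f) 1 (fun q => -q.1 - q.2) (fun q => -q)
    (fun x => ?_) 0 1 1 3 (fun q => by simp) (by norm_num) n hn
  induction x using QuotientAddGroup.induction_on with | H x => ?_
  rw [tetraPerm_mk, AddEquiv.trans_apply, AddEquiv.trans_apply, tetraCoord_mk, tetraCoord_mk,
    show (Equiv.swap 0 1 * Equiv.swap 2 3 : Equiv.Perm (Fin 4)).symm 0 = 1 by decide,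
    show (Equiv.swap 0 1 * Equiv.swap 2 3 : Equiv.Perm (Fin 4)).symm 1 = 0 by decide,
    show (Equiv.swap 0 1 * Equiv.swap 2 3 : Equiv.Perm (Fin 4)).symm 2 = 3 by decide,
    show (Equiv.swap 0 1 * Equiv.swap 2 3 : Equiv.Perm (Fin 4)).symm 3 = 2 by decide]
  ext <;> simp [f]
  ring

/-- For a three-cycle, the line is spanned by the fixed vector `v 3`; on the quotient it satisfies
`X² + X + 1 = 0`. -/
theorem fixedCount_threeCycle_le (n : ℕ) (hn : n ≠ 0) :
    fixedCount (Equiv.swap 0 1 * Equiv.swap 1 2) n ≤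
    36 * ∑ p ∈ n.divisorsAntidiagonal, sublatticeCount (ℤ × ℤ) p.2 := by
  let f : ℤ × ℤ × ℤ ≃+ ℤ × ℤ × ℤ :=
    { toFun := fun x => (-x.2.2, x.1 - x.2.2, x.2.1 - x.2.2)
      invFun := fun x => (x.2.1 - x.1, x.2.2 - x.1, -x.1)
      left_inv := fun x => by simp
      right_inv := fun x => by simp
      map_add' := fun x y => by
        ext <;> simp <;> ring }
  refine fixedCount_le_of_coord _ (tetraCoord.trans f) 1 (fun q => -q.2)
    (fun q => (-q.2, q.1 - q.2))
    (fun x => ?_) 1 1 1 2 (fun q => by ext <;> simp; ring) (by norm_num) n hn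
  induction x using QuotientAddGroup.induction_on with | H x => ?_
  rw [tetraPerm_mk, AddEquiv.trans_apply, AddEquiv.trans_apply, tetraCoord_mk, tetraCoord_mk,
    show (Equiv.swap 0 1 * Equiv.swap 1 2 : Equiv.Perm (Fin 4)).symm 0 = 2 by decide,
    show (Equiv.swap 0 1 * Equiv.swap 1 2 : Equiv.Perm (Fin 4)).symm 1 = 0 by decide,
    show (Equiv.swap 0 1 * Equiv.swap 1 2 : Equiv.Perm (Fin 4)).symm 2 = 1 by decide,
    show (Equiv.swap 0 1 * Equiv.swap 1 2 : Equiv.Perm (Fin 4)).symm 3 = 3 by decide]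
  ext <;> simp [f]

set_option maxRecDepth 4000 in
/-- The square of a four-cycle is a double transposition; every other nontrivial permutation of four
letters is itself conjugate to one of the three. -/
theorem exists_conj_pow_eq (σ : Equiv.Perm (Fin 4)) (hσ : σ ≠ 1) :
    ∃ (τ : Equiv.Perm (Fin 4)) (k : Fin 3), τ * σ ^ (k : ℕ) * τ⁻¹ = Equiv.swap 0 1 ∨
      τ * σ ^ (k : ℕ) * τ⁻¹ = Equiv.swap 0 1 * Equiv.swap 2 3 ∨
      τ * σ ^ (k : ℕ) * τ⁻¹ = Equiv.swap 0 1 * Equiv.swap 1 2 := by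
  revert σ
  decide

theorem fixedCount_le {σ : Equiv.Perm (Fin 4)} (hσ : σ ≠ 1) (n : ℕ) (hn : n ≠ 0) :
    fixedCount σ n ≤ 36 * ∑ p ∈ n.divisorsAntidiagonal, sublatticeCount (ℤ × ℤ) p.2 := by
  obtain ⟨τ, k, h⟩ := exists_conj_pow_eq σ hσ
  refine (fixedCount_le_conj_pow σ τ k n hn).trans ?_
  rcases h with h | h | h <;> rw [h]
  · exact fixedCount_swap_le n hn
  · exact fixedCount_swap_mul_swap_le n hn
  · exact fixedCount_threeCycle_le n hn

/-- The contribution of the nontrivial symmetries to Burnside's lemma. -/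
noncomputable def nontrivialFixedCount (n : ℕ) : ℕ :=
  ∑ σ ∈ Finset.univ.erase (1 : Equiv.Perm (Fin 4)), fixedCount σ n

theorem tetraCount_mul {n : ℕ} (hn : n ≠ 0) :
    tetraCount n * 24 = sublatticeCount (ℤ × ℤ × ℤ) n + nontrivialFixedCount n := by
  rw [← sum_fixedCount n hn, ← Finset.add_sum_erase _ _ (Finset.mem_univ 1), fixedCount_one,
    nontrivialFixedCount]

/-- There are `23` nontrivial permutations, and `828 = 23 * 36`. -/
theorem nontrivialFixedCount_le {n : ℕ} (hn : n ≠ 0) :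
    nontrivialFixedCount n ≤
      828 * ∑ p ∈ n.divisorsAntidiagonal, sublatticeCount (ℤ × ℤ) p.2 := by
  refine (Finset.sum_le_card_nsmul _ _ _ fun σ hσ =>
    fixedCount_le (Finset.ne_of_mem_erase hσ) n hn).trans_eq ?_
  rw [Finset.card_erase_of_mem (Finset.mem_univ _), Finset.card_univ, Fintype.card_perm,
    Fintype.card_fin, smul_eq_mul, ← mul_assoc]
  rfl

/-! ### Dirichlet series -/

open scoped LSeries.notation

theorem term_pow_eq_term_one (k : ℕ) (s : ℂ) :
    LSeries.term (fun n => (n : ℂ) ^ k) s = LSeries.term 1 (s - k) := by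
  ext n
  rcases eq_or_ne n 0 with rfl | hn
  · simp
  · have h0 : (n : ℂ) ≠ 0 := Nat.cast_ne_zero.2 hn
    rw [LSeries.term_of_ne_zero hn, LSeries.term_of_ne_zero hn, Complex.cpow_sub _ _ h0,
      Complex.cpow_natCast, Pi.one_apply, one_div_div]

theorem LSeriesSummable_pow {k : ℕ} {s : ℂ} (hs : k + 1 < s.re) :
    LSeriesSummable (fun n => (n : ℂ) ^ k) s := by
  rw [LSeriesSummable, term_pow_eq_term_one]
  exact LSeriesSummable_one_iff.2 (by simp; linarith)

theorem LSeries_pow {k : ℕ} {s : ℂ} (hs : k + 1 < s.re) :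
    LSeries (fun n => (n : ℂ) ^ k) s = riemannZeta (s - k) := by
  rw [LSeries, term_pow_eq_term_one]
  exact LSeries_one_eq_riemannZeta (by simp; linarith)

theorem sublatticeCount_int_sq_eq_convolution {n : ℕ} (hn : n ≠ 0) :
    (sublatticeCount (ℤ × ℤ) n : ℂ) = ((fun n => (n : ℂ) ^ 1) ⍟ 1) n := by
  rw [LSeries.convolution_def, sublatticeCount_int_sq hn]
  simp

theorem sublatticeCount_int_cube_eq_convolution {n : ℕ} (hn : n ≠ 0) :
    (sublatticeCount (ℤ × ℤ × ℤ) n : ℂ) =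
      ((fun n => (n : ℂ) ^ 2) ⍟ fun n => (sublatticeCount (ℤ × ℤ) n : ℂ)) n := by
  rw [LSeries.convolution_def, sublatticeCount_int_cube hn]
  simp

theorem LSeriesSummable_sublatticeCount_int_sq {s : ℂ} (hs : 2 < s.re) :
    LSeriesSummable (fun n => (sublatticeCount (ℤ × ℤ) n : ℂ)) s := by
  rw [LSeriesSummable_congr s fun {_} => sublatticeCount_int_sq_eq_convolution]
  exact (LSeriesSummable_pow (by norm_num; linarith)).convolution
    (LSeriesSummable_one_iff.2 (by linarith))

theorem LSeries_sublatticeCount_int_sq {s : ℂ} (hs : 2 < s.re) :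
    LSeries (fun n => (sublatticeCount (ℤ × ℤ) n : ℂ)) s =
      riemannZeta (s - 1) * riemannZeta s := by
  rw [LSeries_congr (fun {_} => sublatticeCount_int_sq_eq_convolution), LSeries_convolution'
    (LSeriesSummable_pow (by norm_num; linarith)) (LSeriesSummable_one_iff.2 (by linarith)),
    LSeries_pow (by norm_num; linarith), LSeries_one_eq_riemannZeta (by linarith), Nat.cast_one]

theorem LSeriesSummable_sublatticeCount_int_cube {s : ℂ} (hs : 3 < s.re) :
    LSeriesSummable (fun n => (sublatticeCount (ℤ × ℤ × ℤ) n : ℂ)) s := by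
  rw [LSeriesSummable_congr s fun {_} => sublatticeCount_int_cube_eq_convolution]
  exact (LSeriesSummable_pow (by norm_num; linarith)).convolution
    (LSeriesSummable_sublatticeCount_int_sq (by linarith))

theorem LSeries_sublatticeCount_int_cube {s : ℂ} (hs : 3 < s.re) :
    LSeries (fun n => (sublatticeCount (ℤ × ℤ × ℤ) n : ℂ)) s =
      riemannZeta (s - 2) * (riemannZeta (s - 1) * riemannZeta s) := by
  rw [LSeries_congr (fun {_} => sublatticeCount_int_cube_eq_convolution), LSeries_convolution'
    (LSeriesSummable_pow (by norm_num; linarith))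
    (LSeriesSummable_sublatticeCount_int_sq (by linarith)),
    LSeries_pow (by norm_num; linarith), LSeries_sublatticeCount_int_sq (by linarith)]
  norm_num

theorem LSeriesSummable_of_norm_le_mul {f g : ℕ → ℂ} {C : ℝ} {s : ℂ} (hg : LSeriesSummable g s)
    (h : ∀ n ≠ 0, ‖f n‖ ≤ C * ‖g n‖) : LSeriesSummable f s := by
  refine Summable.of_norm_bounded (hg.norm.mul_left C) fun n => ?_
  rcases eq_or_ne n 0 with rfl | hn
  · rw [LSeries.term_zero, LSeries.term_zero, norm_zero, mul_zero]
  · rw [LSeries.term_of_ne_zero hn, LSeries.term_of_ne_zero hn, norm_div, norm_div,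
      ← mul_div_assoc]
    exact div_le_div_of_nonneg_right (h n hn) (norm_nonneg _)

theorem LSeriesSummable_nontrivialFixedCount {s : ℂ} (hs : 2 < s.re) :
    LSeriesSummable (fun n => (nontrivialFixedCount n : ℂ)) s := by
  have h := (LSeriesSummable_one_iff.2 (by linarith : 1 < s.re)).convolution
    (LSeriesSummable_sublatticeCount_int_sq hs)
  refine LSeriesSummable_of_norm_le_mul (C := (828 : ℕ)) h fun n hn => ?_
  have h1 : (1 ⍟ fun n => (sublatticeCount (ℤ × ℤ) n : ℂ)) n =
      ((∑ p ∈ n.divisorsAntidiagonal, sublatticeCount (ℤ × ℤ) p.2 : ℕ) : ℂ) := by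
    rw [LSeries.convolution_def, Nat.cast_sum]
    exact Finset.sum_congr rfl fun p _ => one_mul _
  rw [h1, Complex.norm_natCast, Complex.norm_natCast, ← Nat.cast_mul]
  exact Nat.cast_le.2 (nontrivialFixedCount_le hn)

theorem tetraCount_eq {n : ℕ} (hn : n ≠ 0) :
    (tetraCount n : ℂ) =
      ((fun n => (sublatticeCount (ℤ × ℤ × ℤ) n : ℂ)) + fun n => (nontrivialFixedCount n : ℂ)) n
        / 24 := by
  rw [eq_div_iff (by norm_num), Pi.add_apply]
  exact_mod_cast tetraCount_mul hn

theorem LSeriesSummable_tetraCount {s : ℂ} (hs : 3 < s.re) :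
    LSeriesSummable (fun n => (tetraCount n : ℂ)) s := by
  have h := ((LSeriesSummable_sublatticeCount_int_cube hs).add
    (LSeriesSummable_nontrivialFixedCount (by linarith))).smul (1 / 24 : ℂ)
  refine (LSeriesSummable_congr s fun {n} hn => ?_).2 h
  rw [tetraCount_eq hn, Pi.smul_apply, smul_eq_mul, one_div, div_eq_inv_mul]

/-- The continuation of the Dirichlet series of `tetraCount` to `Re s > 2`: by Burnside's lemma, one
twenty-fourth of `ζ(s - 2) ζ(s - 1) ζ(s)` plus a series that converges there. -/
noncomputable def tetraZeta (s : ℂ) : ℂ :=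
  (riemannZeta (s - 2) * (riemannZeta (s - 1) * riemannZeta s) +
    LSeries (fun n => (nontrivialFixedCount n : ℂ)) s) / 24

theorem tetraZeta_eq_LSeries {s : ℂ} (hs : 3 < s.re) :
    tetraZeta s = LSeries (fun n => (tetraCount n : ℂ)) s := by
  have h : LSeries (fun n => (tetraCount n : ℂ)) s = LSeries ((1 / 24 : ℂ) •
      ((fun n => (sublatticeCount (ℤ × ℤ × ℤ) n : ℂ)) + fun n => (nontrivialFixedCount n : ℂ))) s :=
    LSeries_congr (fun {n} hn => by
      rw [tetraCount_eq hn, Pi.smul_apply, smul_eq_mul, one_div, div_eq_inv_mul]) s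
  rw [h, LSeries_smul, LSeries_add (LSeriesSummable_sublatticeCount_int_cube hs)
    (LSeriesSummable_nontrivialFixedCount (by linarith)), LSeries_sublatticeCount_int_cube hs,
    tetraZeta, one_div, div_eq_inv_mul]

theorem analyticAt_riemannZeta {s : ℂ} (hs : s ≠ 1) : AnalyticAt ℂ riemannZeta s := by
  refine DifferentiableOn.analyticAt (s := {1}ᶜ) (fun z hz => ?_)
    (isOpen_compl_singleton.mem_nhds hs)
  exact (differentiableAt_riemannZeta hz).differentiableWithinAt

theorem analyticAt_riemannZeta_sub {s a : ℂ} (hs : s ≠ a + 1) :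
    AnalyticAt ℂ (fun z => riemannZeta (z - a)) s :=
  (analyticAt_riemannZeta fun h => hs (by rw [← h]; ring)).comp_of_eq
    (analyticAt_id.sub analyticAt_const) rfl

theorem analyticAt_LSeries_nontrivialFixedCount {s : ℂ} (hs : 2 < s.re) :
    AnalyticAt ℂ (LSeries fun n => (nontrivialFixedCount n : ℂ)) s := by
  refine LSeries_analyticOnNhd _ s (lt_of_le_of_lt (b := ((2 : ℝ) : EReal)) ?_ ?_)
  · refine LSeries.abscissaOfAbsConv_le_of_forall_lt_LSeriesSummable fun y hy => ?_
    exact LSeriesSummable_nontrivialFixedCount (by simpa using hy)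
  · exact_mod_cast hs

theorem ne_of_two_lt_re {s : ℂ} (hs : 2 < s.re) : s ≠ 1 ∧ s ≠ 1 + 1 := by
  constructor <;> rintro rfl <;> norm_num at hs

theorem analyticAt_tetraZeta {s : ℂ} (hs : 2 < s.re) (h3 : s ≠ 3) :
    AnalyticAt ℂ tetraZeta s := by
  obtain ⟨h1, h2⟩ := ne_of_two_lt_re hs
  exact (((analyticAt_riemannZeta_sub (by norm_num [h3])).mul
    ((analyticAt_riemannZeta_sub h2).mul (analyticAt_riemannZeta h1))).add
    (analyticAt_LSeries_nontrivialFixedCount hs)).div_const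

theorem tendsto_sub_three_mul_tetraZeta :
    Tendsto (fun s : ℂ => (s - 3) * tetraZeta s) (𝓝[≠] 3)
      (𝓝 (riemannZeta 2 * riemannZeta 3 / 24)) := by
  have hshift : Tendsto (fun s : ℂ => s - 2) (𝓝[≠] 3) (𝓝[≠] 1) := by
    refine tendsto_nhdsWithin_iff.2 ⟨?_, ?_⟩
    · refine Tendsto.mono_left ?_ nhdsWithin_le_nhds
      exact Continuous.tendsto' (by fun_prop) _ _ (by norm_num)
    · filter_upwards [self_mem_nhdsWithin] with s hs h
      exact hs (by rw [Set.mem_singleton_iff] at h ⊢; linear_combination h)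
  have hres := riemannZeta_residue_one.comp hshift
  have h3 : (2 : ℝ) < (3 : ℂ).re := by norm_num
  obtain ⟨hne1, hne2⟩ := ne_of_two_lt_re h3
  have hz : Tendsto (fun s : ℂ => riemannZeta (s - 1) * riemannZeta s) (𝓝[≠] 3)
      (𝓝 (riemannZeta (3 - 1) * riemannZeta 3)) :=
    ((analyticAt_riemannZeta_sub hne2).mul
      (analyticAt_riemannZeta hne1)).continuousAt.tendsto.mono_left nhdsWithin_le_nhds
  have hg : Tendsto (fun s : ℂ => (s - 3) * LSeries (fun n => (nontrivialFixedCount n : ℂ)) s)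
      (𝓝[≠] 3) (𝓝 ((3 - 3) * LSeries (fun n => (nontrivialFixedCount n : ℂ)) 3)) :=
    ((analyticAt_id.sub analyticAt_const).mul
      (analyticAt_LSeries_nontrivialFixedCount h3)).continuousAt.tendsto.mono_left
      nhdsWithin_le_nhds
  have := ((hres.mul hz).add hg).div_const 24
  rw [show (3 : ℂ) - 1 = 2 by norm_num, sub_self, zero_mul, add_zero, one_mul] at this
  refine this.congr fun s => ?_
  simp only [tetraZeta, Function.comp_apply]
  ring

theorem riemannZeta_two_mul_three_ne_zero : riemannZeta 2 * riemannZeta 3 ≠ 0 :=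
  mul_ne_zero (riemannZeta_ne_zero_of_one_lt_re (by norm_num))
    (riemannZeta_ne_zero_of_one_lt_re (by norm_num))

/-- The function `(s - 3) * tetraZeta s`, with its limit as value at the pole, is analytic. -/
theorem meromorphicAt_tetraZeta :
    MeromorphicAt tetraZeta 3 ∧ meromorphicOrderAt tetraZeta 3 = -1 := by
  set c := riemannZeta 2 * riemannZeta 3 / 24 with hc
  have hc0 : c ≠ 0 := div_ne_zero riemannZeta_two_mul_three_ne_zero (by norm_num)
  let g : ℂ → ℂ := Function.update (fun s => (s - 3) * tetraZeta s) 3 c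
  have hne : ∀ᶠ s in 𝓝[≠] (3 : ℂ), (2 : ℝ) < s.re ∧ s ≠ 3 := by
    refine Filter.Eventually.and ?_ self_mem_nhdsWithin
    exact nhdsWithin_le_nhds ((isOpen_lt continuous_const Complex.continuous_re).mem_nhds
      (by norm_num))
  have hgeq : ∀ᶠ s in 𝓝[≠] (3 : ℂ), tetraZeta s = (s - 3) ^ (-1 : ℤ) • g s := by
    filter_upwards [self_mem_nhdsWithin] with s hs
    have hs' : s - 3 ≠ 0 := sub_ne_zero.2 hs
    rw [show g s = (s - 3) * tetraZeta s from Function.update_of_ne hs _ _, zpow_neg_one,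
      smul_eq_mul, inv_mul_cancel_left₀ hs']
  have hg : AnalyticAt ℂ g 3 := by
    refine Complex.analyticAt_of_differentiable_on_punctured_nhds_of_continuousAt ?_ ?_
    · filter_upwards [hne] with s hs
      have h : DifferentiableAt ℂ (fun s => (s - 3) * tetraZeta s) s :=
        (differentiableAt_id.sub_const 3).mul (analyticAt_tetraZeta hs.1 hs.2).differentiableAt
      refine h.congr_of_eventuallyEq ?_
      filter_upwards [isOpen_compl_singleton.mem_nhds hs.2] with z hz
      exact Function.update_of_ne hz _ _
    · exact continuousAt_update_same.2 tendsto_sub_three_mul_tetraZeta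
  have hg3 : g 3 ≠ 0 := by simpa [g] using hc0
  have hmer : MeromorphicAt tetraZeta 3 := by
    rw [MeromorphicAt.meromorphicAt_congr hgeq]
    fun_prop
  exact ⟨hmer, (meromorphicOrderAt_eq_int_iff hmer).2 ⟨g, hg, hg3, hgeq⟩⟩

/-! ### Partial sums -/

theorem sum_sublatticeCount_int_cube (N : ℕ) :
    ∑ n ∈ Finset.Icc 1 N, (sublatticeCount (ℤ × ℤ × ℤ) n : ℂ) =
      ∑ b ∈ Finset.Icc 1 N, (sublatticeCount (ℤ × ℤ) b : ℂ) *
        ((∑ d ∈ Finset.Icc 1 (N / b), (d : ℝ) ^ 2 : ℝ) : ℂ) := by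
  have hIcc (M : ℕ) : Finset.Icc 1 M = Finset.Ioc 0 M := rfl
  have h := ArithmeticFunction.sum_Ioc_mul_eq_sum_sum
    (toArithmeticFunction fun n => (sublatticeCount (ℤ × ℤ) n : ℂ))
    (toArithmeticFunction fun n => (n : ℂ) ^ 2) N
  rw [mul_comm] at h
  simp only [hIcc]
  have hne {M n : ℕ} (hn : n ∈ Finset.Ioc 0 M) : n ≠ 0 := (Finset.mem_Ioc.1 hn).1.ne'
  refine Eq.trans (Finset.sum_congr rfl fun n hn => ?_)
    (h.trans (Finset.sum_congr rfl fun n hn => ?_))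
  · exact sublatticeCount_int_cube_eq_convolution (hne hn)
  · rw [show toArithmeticFunction (fun n => (sublatticeCount (ℤ × ℤ) n : ℂ)) n = _ from
      if_neg (hne hn), Complex.ofReal_sum]
    congr 1
    refine Finset.sum_congr rfl fun m hm => ?_
    rw [show toArithmeticFunction (fun n => (n : ℂ) ^ 2) m = _ from if_neg (hne hm)]
    push_cast
    rfl

theorem sum_Icc_sq (x : ℕ) :
    ∑ d ∈ Finset.Icc 1 x, (d : ℝ) ^ 2 = x * (x + 1) * (2 * x + 1) / 6 := by
  induction x with
  | zero => simp
  | succ x ih =>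
    rw [Finset.sum_Icc_succ_top (by omega), ih]
    push_cast
    ring

theorem sum_Icc_sq_le (x : ℕ) : ∑ d ∈ Finset.Icc 1 x, (d : ℝ) ^ 2 ≤ (x : ℝ) ^ 3 := by
  calc ∑ d ∈ Finset.Icc 1 x, (d : ℝ) ^ 2 ≤ (Finset.Icc 1 x).card • (x : ℝ) ^ 2 :=
        Finset.sum_le_card_nsmul _ _ _ fun d hd => by
          have : (d : ℝ) ≤ x := Nat.cast_le.2 (Finset.mem_Icc.1 hd).2
          gcongr
    _ = (x : ℝ) ^ 3 := by
        rw [Nat.card_Icc, nsmul_eq_mul, Nat.add_sub_cancel]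
        ring

theorem tendsto_natDiv_div_atTop (b : ℕ) :
    Tendsto (fun N : ℕ => ((N / b : ℕ) : ℝ) / N) atTop (𝓝 (1 / b)) := by
  have h := (tendsto_nat_floor_mul_div_atTop (R := ℝ) (a := 1 / b) (by positivity)).comp
    tendsto_natCast_atTop_atTop
  refine h.congr fun N => ?_
  rw [Function.comp_apply, one_div_mul_eq_div, Nat.floor_div_eq_div]

theorem tendsto_sum_Icc_sq_div (b : ℕ) :
    Tendsto (fun N : ℕ => (∑ d ∈ Finset.Icc 1 (N / b), (d : ℝ) ^ 2) / (N : ℝ) ^ 3) atTop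
      (𝓝 (1 / (3 * (b : ℝ) ^ 3))) := by
  have h := tendsto_natDiv_div_atTop b
  have h0 : Tendsto (fun N : ℕ => 1 / (N : ℝ)) atTop (𝓝 0) :=
    tendsto_const_div_atTop_nhds_zero_nat 1
  have h1 := ((h.mul (h.add h0)).mul ((h.const_mul 2).add h0)).div_const 6
  have e : 1 / (b : ℝ) * (1 / b + 0) * (2 * (1 / b) + 0) / 6 = 1 / (3 * (b : ℝ) ^ 3) := by
    rcases eq_or_ne (b : ℝ) 0 with hb | hb
    · simp [hb]
    · field_simp
      norm_num
  rw [e] at h1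
  refine h1.congr' ?_
  filter_upwards [eventually_ne_atTop 0] with N hN
  have : (N : ℝ) ≠ 0 := Nat.cast_ne_zero.2 hN
  rw [sum_Icc_sq]
  field_simp

/-- The majorant for dominated convergence. -/
theorem norm_sum_Icc_sq_div_le (N b : ℕ) :
    ‖(((∑ d ∈ Finset.Icc 1 (N / b), (d : ℝ) ^ 2) / (N : ℝ) ^ 3 : ℝ) : ℂ)‖ ≤ 1 / (b : ℝ) ^ 3 := by
  rw [Complex.norm_real, Real.norm_of_nonneg (by positivity)]
  rcases eq_or_ne N 0 with rfl | hN
  · simp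
  have hN' : (0 : ℝ) < N := Nat.cast_pos.2 (Nat.pos_of_ne_zero hN)
  have h1 : ((N / b : ℕ) : ℝ) / N ≤ 1 / b := by
    rw [div_le_iff₀ hN', one_div_mul_eq_div]
    exact Nat.cast_div_le
  calc _ ≤ ((N / b : ℕ) : ℝ) ^ 3 / (N : ℝ) ^ 3 := by
        gcongr
        exact sum_Icc_sq_le _
    _ = (((N / b : ℕ) : ℝ) / N) ^ 3 := (div_pow _ _ _).symm
    _ ≤ (1 / b) ^ 3 := by gcongr
    _ = 1 / (b : ℝ) ^ 3 := by rw [div_pow, one_pow]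

/-- At `n = 0` both sides vanish, the right-hand one because `1 / 0 = 0`. -/
theorem LSeries_term_three (f : ℕ → ℂ) (n : ℕ) : LSeries.term f 3 n = f n * (1 / (n : ℂ) ^ 3) := by
  rcases eq_or_ne n 0 with rfl | hn
  · simp
  · rw [LSeries.term_of_ne_zero hn, mul_one_div]
    congr 1
    exact_mod_cast Complex.cpow_natCast (n : ℂ) 3

/-- The number of sublattices of `ℤ³` of index at most `N` is asymptotic to `ζ(2) ζ(3) N³ / 3`: sum
over the index `b` of the projection to `ℤ²`, by dominated convergence. -/
theorem tendsto_sum_sublatticeCount_int_cube :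
    Tendsto (fun N : ℕ => (∑ n ∈ Finset.Icc 1 N, (sublatticeCount (ℤ × ℤ × ℤ) n : ℂ)) / (N : ℂ) ^ 3)
      atTop (𝓝 (riemannZeta 2 * riemannZeta 3 / 3)) := by
  let a : ℕ → ℂ := fun n => (sublatticeCount (ℤ × ℤ) n : ℂ)
  let f : ℕ → ℕ → ℂ := fun N b =>
    a b * (((∑ d ∈ Finset.Icc 1 (N / b), (d : ℝ) ^ 2) / (N : ℝ) ^ 3 : ℝ) : ℂ)
  have hs : LSeriesSummable a 3 := LSeriesSummable_sublatticeCount_int_sq (by norm_num)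
  have h := tendsto_tsum_of_dominated_convergence (𝓕 := atTop) (f := f)
    (g := fun b => LSeries.term a 3 b / 3) hs.norm (fun b => ?_) (.of_forall fun N b => ?_)
  · have e : ∑' b, LSeries.term a 3 b / 3 = riemannZeta 2 * riemannZeta 3 / 3 := by
      rw [tsum_div_const]
      congr 1
      have := LSeries_sublatticeCount_int_sq (s := 3) (by norm_num)
      rwa [show (3 : ℂ) - 1 = 2 by norm_num] at this
    rw [e] at h
    refine h.congr fun N => ?_
    rw [sum_sublatticeCount_int_cube, Finset.sum_div, tsum_eq_sum (s := Finset.Icc 1 N)]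
    · refine Finset.sum_congr rfl fun b _ => ?_
      simp only [f, a]
      rw [Complex.ofReal_div, mul_div_assoc]
      push_cast
      rfl
    · intro b hb
      have : N / b = 0 := by
        rcases Nat.eq_zero_or_pos b with rfl | hb0
        · simp
        · exact Nat.div_eq_of_lt (by
            rw [Finset.mem_Icc] at hb
            omega)
      simp [f, this]
  · have := ((Complex.continuous_ofReal.tendsto _).comp (tendsto_sum_Icc_sq_div b)).const_mul (a b)
    rw [LSeries_term_three]
    have e : a b * (1 / (b : ℂ) ^ 3) / 3 = a b * ((1 / (3 * (b : ℝ) ^ 3) : ℝ) : ℂ) := by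
      push_cast
      rw [one_div, one_div, mul_inv]
      ring
    rw [e]
    exact this
  · rw [norm_mul, LSeries_term_three, norm_mul]
    refine mul_le_mul_of_nonneg_left ((norm_sum_Icc_sq_div_le N b).trans_eq ?_) (norm_nonneg _)
    simp

/-- If `∑ g(n) n⁻³` converges absolutely, then the partial sums of `g` are `o(N³)`. -/
theorem tendsto_sum_div_cube_of_LSeriesSummable {g : ℕ → ℂ} (hg : LSeriesSummable g 3) :
    Tendsto (fun N : ℕ => (∑ n ∈ Finset.Icc 1 N, g n) / (N : ℂ) ^ 3) atTop (𝓝 0) := by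
  have h := tendsto_tsum_of_dominated_convergence (𝓕 := atTop)
    (f := fun N n => if n ∈ Finset.Icc 1 N then g n / (N : ℂ) ^ 3 else 0)
    (g := fun _ : ℕ => (0 : ℂ)) hg.norm (fun n => ?_) (.of_forall fun N n => ?_)
  · rw [tsum_zero] at h
    refine h.congr fun N => ?_
    rw [Finset.sum_div, tsum_eq_sum (s := Finset.Icc 1 N) fun n hn => if_neg hn]
    exact Finset.sum_congr rfl fun n hn => if_pos hn
  · have h0 : Tendsto (fun N : ℕ => g n / (N : ℂ) ^ 3) atTop (𝓝 0) := by
      have := (tendsto_inv_atTop_nhds_zero_nat (𝕜 := ℂ)).pow 3 |>.const_mul (g n)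
      simpa [div_eq_mul_inv] using this
    refine squeeze_zero_norm (fun N => ?_) (tendsto_zero_iff_norm_tendsto_zero.1 h0)
    split_ifs <;> simp
    positivity
  · split_ifs with hn
    · rw [Finset.mem_Icc] at hn
      have h1 : (0 : ℝ) < n := Nat.cast_pos.2 hn.1
      have h2 : (n : ℝ) ≤ N := Nat.cast_le.2 hn.2
      rw [LSeries_term_three, mul_one_div, norm_div, norm_div, norm_pow, norm_pow,
        Complex.norm_natCast, Complex.norm_natCast]
      gcongr
    · simp

theorem isEquivalent_sum_tetraCount :
    (fun N : ℕ => ∑ n ∈ Finset.Icc 1 N, (tetraCount n : ℂ)) ~[atTop]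
      (fun N : ℕ => riemannZeta 2 * riemannZeta 3 / 72 * (N : ℂ) ^ 3) := by
  set c := riemannZeta 2 * riemannZeta 3 with hc
  have hc0 : c ≠ 0 := riemannZeta_two_mul_three_ne_zero
  have h := ((tendsto_sum_sublatticeCount_int_cube.add (tendsto_sum_div_cube_of_LSeriesSummable
    (LSeriesSummable_nontrivialFixedCount (s := 3) (by norm_num)))).div_const 24).div_const (c / 72)
  rw [← hc, add_zero, show c / 3 / 24 / (c / 72) = 1 by field_simp; norm_num] at h
  refine isEquivalent_of_tendsto_one (h.congr fun N => ?_)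
  have hsum : ∑ n ∈ Finset.Icc 1 N, (tetraCount n : ℂ) =
      (∑ n ∈ Finset.Icc 1 N, (sublatticeCount (ℤ × ℤ × ℤ) n : ℂ) +
        ∑ n ∈ Finset.Icc 1 N, (nontrivialFixedCount n : ℂ)) / 24 := by
    rw [← Finset.sum_add_distrib, Finset.sum_div]
    refine Finset.sum_congr rfl fun n hn => tetraCount_eq ?_
    have := (Finset.mem_Icc.1 hn).1
    omega
  rw [Pi.div_apply, hsum, ← add_div, div_div, div_div, div_div]
  congr 1
  ring

/-! ### The numerical value of the constant -/

/-- The summand `1 / n³` is at most `1 / ((n - 1) n (n + 1))`, whose sum telescopes. -/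
theorem sum_range_one_div_cube_le (m : ℕ) :
    (∑ n ∈ Finset.range (m + 11), 1 / (n : ℝ) ^ 3 : ℝ) ≤
      (∑ n ∈ Finset.range 11, 1 / (n : ℝ) ^ 3 : ℝ) + 1 / 220 -
        1 / (2 * ((m : ℝ) + 10) * ((m : ℝ) + 11)) := by
  induction m with
  | zero => norm_num
  | succ m ih =>
    rw [show m + 1 + 11 = (m + 11) + 1 by ring, Finset.sum_range_succ]
    have h : 1 / ((m + 11 : ℕ) : ℝ) ^ 3 ≤
        1 / (2 * (m + 10) * (m + 11)) - 1 / (2 * ((m + 1 : ℕ) + 10) * ((m + 1 : ℕ) + 11)) := by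
      have e : 1 / (2 * ((m : ℝ) + 10) * (m + 11)) -
          1 / (2 * ((m + 1 : ℕ) + 10) * ((m + 1 : ℕ) + 11)) =
          1 / ((m + 10) * (m + 11) * (m + 12)) := by
        push_cast
        field_simp
        ring
      rw [e]
      push_cast
      gcongr
      nlinarith [(Nat.cast_nonneg m : (0 : ℝ) ≤ m)]
    linarith

/-- The sum of the first ten terms from below, and with the telescoping bound for the tail from
above. -/
theorem riemannZeta_three_bounds :
    ∃ z : ℝ, riemannZeta 3 = z ∧ 1.1975 ≤ z ∧ z ≤ 1.2026 := by
  have hs : Summable fun n : ℕ => 1 / (n : ℝ) ^ 3 := Real.summable_one_div_nat_pow.2 (by norm_num)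
  have hsum : ∑ n ∈ Finset.range 11, 1 / (n : ℝ) ^ 3 ≤ 1.1976 ∧
      1.1975 ≤ ∑ n ∈ Finset.range 11, 1 / (n : ℝ) ^ 3 := by
    norm_num [Finset.sum_range_succ]
  refine ⟨∑' n : ℕ, 1 / (n : ℝ) ^ 3, ?_, ?_, ?_⟩
  · have := zeta_nat_eq_tsum_of_gt_one (k := 3) (by norm_num)
    push_cast at this ⊢
    exact this
  · exact hsum.2.trans (hs.sum_le_tsum _ fun n _ => by positivity)
  · refine Real.tsum_le_of_sum_range_le (fun n => by positivity) fun n => ?_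
    calc ∑ i ∈ Finset.range n, 1 / (i : ℝ) ^ 3 ≤ ∑ i ∈ Finset.range (n + 11), 1 / (i : ℝ) ^ 3 :=
          Finset.sum_le_sum_of_subset_of_nonneg (Finset.range_mono (by omega))
            fun i _ _ => by positivity
      _ ≤ _ := sum_range_one_div_cube_le n
      _ ≤ 1.1976 + 1 / 220 - 0 := by
          gcongr
          · exact hsum.1
          · positivity
      _ ≤ 1.2026 := by norm_num

theorem norm_zeta_two_mul_zeta_three_sub_lt :
    ‖riemannZeta 2 * riemannZeta 3 / 72 - 0.0274‖ < 0.0001 := by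
  obtain ⟨z, hz, h1, h2⟩ := riemannZeta_three_bounds
  have e : riemannZeta 2 * riemannZeta 3 / 72 - 0.0274 =
      ((Real.pi ^ 2 / 6 * z / 72 - 0.0274 : ℝ) : ℂ) := by
    rw [hz, riemannZeta_two]
    push_cast
    norm_num
  have hp1 := Real.pi_gt_d4
  have hp2 := Real.pi_lt_d4
  have hq1 : 9.869 ≤ Real.pi ^ 2 := by nlinarith
  have hq2 : Real.pi ^ 2 ≤ 9.8697 := by nlinarith
  rw [e, Complex.norm_real, Real.norm_eq_abs, abs_lt]
  constructor <;> nlinarith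

/-! ### The counting function of the tetrahedral lattice -/

theorem mainTheorem7 :
    -- the counting function of the lattice counts the Abelian orbifolds of `ℂ⁴`
    (∀ n : ℕ, 0 < n → abelianOrbifoldCount n = tetraCount n) ∧
    -- the asymptotic formula for the partial sums
    ((fun N : ℕ => ∑ n ∈ Finset.Icc 1 N, (tetraCount n : ℂ)) ~[atTop]
      (fun N : ℕ => riemannZeta 2 * riemannZeta 3 / 72 * (N : ℂ) ^ 3)) ∧
    -- the numerical value of the constant
    ‖riemannZeta 2 * riemannZeta 3 / 72 - 0.0274‖ < 0.0001 ∧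
    -- the Dirichlet series converges for `Re s > 3`
    (∀ s : ℂ, 3 < s.re → LSeriesSummable (fun n => (tetraCount n : ℂ)) s) ∧
    -- and its continuation has `s = 3` as its rightmost pole, which is simple
    (∃ F : ℂ → ℂ,
      (∀ s : ℂ, 3 < s.re → F s = LSeries (fun n => (tetraCount n : ℂ)) s) ∧
      (∀ s : ℂ, 2 < s.re → s ≠ 3 → AnalyticAt ℂ F s) ∧
      MeromorphicAt F 3 ∧
      meromorphicOrderAt F 3 = -1 ∧
      Tendsto (fun s : ℂ => (s - 3) * F s) (𝓝[≠] 3)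
        (𝓝 (riemannZeta 2 * riemannZeta 3 / 24))) := by
  refine ⟨fun n hn => abelianOrbifoldCount_eq_tetraCount hn, isEquivalent_sum_tetraCount,
    norm_zeta_two_mul_zeta_three_sub_lt, fun s hs => LSeriesSummable_tetraCount hs,
    tetraZeta, fun s hs => tetraZeta_eq_LSeries hs, fun s hs h3 => analyticAt_tetraZeta hs h3,
    meromorphicAt_tetraZeta.1, meromorphicAt_tetraZeta.2, tendsto_sub_three_mul_tetraZeta⟩
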